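/- Let $s\ge 2$ be an even integer. Consider the No Restart Random Walk (NRRW) with step parameter $s$: at time $0$ the graph $G_0$ consists of a single vertex $0$ (the root) with a self-loop, and the walker is at $W_0=0$. For each $t\ge 0$, given the past, the walker moves from $W_t$ to $W_{t+1}$ by one step of the simple (symmetric) random walk on the current undirected graph $G_t$, i.e. along an edge at $W_t$ chosen uniformly at random, where the self-loop at the root may be counted either once (the root is one of its own neighbours) or twice (the loop has two edge ends); the claim holds under both conventions. If $t+1=ks$ for an integer $k\ge 1$, then immediately after the move a new vertex labelled $k$ is added and joined by a single edge to $W_{t+1}$, giving $G_{t+1}$; otherwise $G_{t+1}=G_t$. Thus $G_t$ has vertex set $\{0,1,\dots,\lfloor t/s\rfloor\}$ and every $i\in\mathbb N$ is a vertex from time $is$ on. Then every vertex is recurrent: for every $i\in\mathbb N$, $$\mathbb P\bigl(W_t=i\ \text{for infinitely many } t\bigr)=1 .$$ -/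

import Mathlib

open MeasureTheory ProbabilityTheory Filter
open scoped ENNReal

namespace NRRW

/-- The graph present at time `t` when the walker's trajectory is `w`. It is an undirected graph
with loops on natural-number labels, given by its edge set (every vertex is an end of an edge).
It starts as the single vertex `0`, the root, with a self-loop. At every positive time `t = k * s`,
right after the walker's move, the new vertex `k` is joined by one edge to the walker's
position `w t`. -/
def graph (s : ℕ) (w : ℕ → ℕ) : ℕ → Finset (Sym2 ℕ)
  | 0 => {s(0, 0)}
  | t + 1 =>
    if s ∣ t + 1 then insert s((t + 1) / s, w (t + 1)) (graph s w t) else graph s w t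

/-- The vertices of a graph given by its edge set: all ends of edges. -/
def verts (E : Finset (Sym2 ℕ)) : Finset ℕ := E.biUnion Sym2.toFinset

/-- The number of ways to step from `x` to `y` in the graph `E`, when a self-loop counts
`ℓ` times and every other edge counts once. -/
def mult (ℓ : ℕ) (E : Finset (Sym2 ℕ)) (x y : ℕ) : ℕ :=
  if s(x, y) ∈ E then (if x = y then ℓ else 1) else 0

/-- The degree of `x` in `E`, a self-loop being counted `ℓ` times. -/
def degree (ℓ : ℕ) (E : Finset (Sym2 ℕ)) (x : ℕ) : ℕ := ∑ y ∈ verts E, mult ℓ E x y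

/-- The probability that one step of the symmetric random walk on `E` leads from `x` to `y`. -/
noncomputable def stepProb (ℓ : ℕ) (E : Finset (Sym2 ℕ)) (x y : ℕ) : ℝ≥0∞ :=
  (mult ℓ E x y : ℝ≥0∞) / (degree ℓ E x : ℝ≥0∞)

/-- `W` is the walker of a No Restart Random Walk with step parameter `s`: it starts at the root,
and, given its trajectory up to time `t` (which determines the graphs up to time `t`), its
position at time `t + 1` is chosen by one step of the symmetric random walk on the graph present
at time `t`. The graph process of the model is `fun t ω ↦ graph s (fun r ↦ W r ω) t`. -/
structure IsNRRW {Ω : Type*} [MeasurableSpace Ω] (s ℓ : ℕ) (P : Measure Ω)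
    (W : ℕ → Ω → ℕ) : Prop where
  measurable : ∀ t, Measurable (W t)
  start : ∀ᵐ ω ∂P, W 0 ω = 0
  step : ∀ (t : ℕ) (w : ℕ → ℕ),
    P {ω | ∀ r ≤ t + 1, W r ω = w r} =
      P {ω | ∀ r ≤ t, W r ω = w r} * stepProb ℓ (graph s w t) (w t) (w (t + 1))

/-- A vertex `i` is recurrent: the walker visits it infinitely often almost surely. -/
def Recurrent {Ω : Type*} [MeasurableSpace Ω] (P : Measure Ω) (W : ℕ → Ω → ℕ) (i : ℕ) : Prop :=
  ∀ᵐ ω ∂P, ∃ᶠ t in atTop, W t ω = i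

/-! ### The model exists -/

lemma graph_congr (s : ℕ) {w w' : ℕ → ℕ} : ∀ {t : ℕ}, (∀ r ≤ t, w r = w' r) →
    graph s w t = graph s w' t
  | 0, _ => rfl
  | t + 1, h => by
    simp only [graph, graph_congr s (fun r hr => h r (hr.trans (Nat.le_succ t))), h (t + 1) le_rfl]

lemma graph_mono (s : ℕ) (w : ℕ → ℕ) (t : ℕ) : graph s w t ⊆ graph s w (t + 1) := by
  simp only [graph]; split_ifs
  · exact Finset.subset_insert _ _
  · exact subset_rfl

lemma mult_ne_zero {ℓ : ℕ} (hℓ : 1 ≤ ℓ) {E : Finset (Sym2 ℕ)} {x y : ℕ} :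
    mult ℓ E x y ≠ 0 ↔ s(x, y) ∈ E := by
  unfold mult; split_ifs <;> (simp_all; try omega)

lemma degree_ne_zero {ℓ : ℕ} (hℓ : 1 ≤ ℓ) {E : Finset (Sym2 ℕ)} {x : ℕ}
    (h : ∃ y, s(x, y) ∈ E) : degree ℓ E x ≠ 0 := by
  obtain ⟨y, hy⟩ := h
  have hm := (mult_ne_zero hℓ).2 hy
  have hv : y ∈ verts E := Finset.mem_biUnion.2 ⟨_, hy, by simp⟩
  have := Finset.single_le_sum (f := fun y => mult ℓ E x y) (fun _ _ => Nat.zero_le _) hv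
  unfold degree
  have h2 : mult ℓ E x y ≤ ∑ y ∈ verts E, mult ℓ E x y := this
  omega

lemma sum_stepProb {ℓ : ℕ} {E : Finset (Sym2 ℕ)} {x : ℕ} (h : degree ℓ E x ≠ 0) :
    ∑ y ∈ verts E, stepProb ℓ E x y = 1 := by
  simp only [stepProb, div_eq_mul_inv]
  rw [← Finset.sum_mul, ← Nat.cast_sum]
  exact ENNReal.mul_inv_cancel (by exact_mod_cast h) (ENNReal.natCast_ne_top _)

lemma stepProb_eq_zero {ℓ : ℕ} {E : Finset (Sym2 ℕ)} {x y : ℕ} (h : y ∉ verts E) :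
    stepProb ℓ E x y = 0 := by
  have : s(x, y) ∉ E := fun hE => h (Finset.mem_biUnion.2 ⟨_, hE, by simp⟩)
  simp [stepProb, mult, this]

open Classical in
/-- One step of the walk as a probability mass function (with a dummy value off the graph). -/
noncomputable def stepPMF (ℓ : ℕ) (E : Finset (Sym2 ℕ)) (x : ℕ) : PMF ℕ :=
  if h : degree ℓ E x ≠ 0 then
    PMF.ofFinset (stepProb ℓ E x) (verts E) (sum_stepProb h) (fun _ ha => stepProb_eq_zero ha)
  else PMF.pure 0

/-- A finite trajectory, extended by `0`. -/
def extend {t : ℕ} (u : (i : Finset.Iic t) → ℕ) (r : ℕ) : ℕ :=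
  if h : r ≤ t then u ⟨r, Finset.mem_Iic.2 h⟩ else 0

/-- The transition kernels of the walker given its past. -/
noncomputable def stepKernel (s ℓ t : ℕ) : Kernel ((i : Finset.Iic t) → ℕ) ℕ :=
  Kernel.ofFunOfCountable fun u =>
    (stepPMF ℓ (graph s (extend u) t) (extend u t)).toMeasure

instance (s ℓ t : ℕ) : IsMarkovKernel (stepKernel s ℓ t) :=
  ⟨fun u => by
    change IsProbabilityMeasure (PMF.toMeasure _)
    infer_instance⟩

/-- The law of the walker's trajectory. -/
noncomputable def law (s ℓ : ℕ) : Measure (ℕ → ℕ) :=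
  Kernel.trajMeasure (X := fun _ => ℕ) (Measure.dirac 0) (stepKernel s ℓ)

instance (s ℓ : ℕ) : IsProbabilityMeasure (law s ℓ) := by unfold law; infer_instance

lemma law_start (s ℓ : ℕ) : ∀ᵐ w ∂law s ℓ, w 0 = 0 := by
  have h : (law s ℓ).map (Preorder.frestrictLe (π := fun _ => ℕ) 0) =
      (Measure.dirac 0).map
        (MeasurableEquiv.piUnique (fun _ : Finset.Iic 0 => ℕ)).symm := by
    rw [law, Kernel.trajMeasure, Measure.map_comp _ _ (by fun_prop),
      Kernel.traj_map_frestrictLe, Kernel.partialTraj_self, Measure.id_comp]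
  have h2 : (law s ℓ).map (fun w => w 0) = Measure.dirac 0 := by
    have : (fun w : ℕ → ℕ => w 0) = (MeasurableEquiv.piUnique (fun _ : Finset.Iic 0 => ℕ)) ∘
        (Preorder.frestrictLe (π := fun _ => ℕ) 0) := by
      ext w; rfl
    rw [this, ← Measure.map_map (by fun_prop) (by fun_prop), h,
      Measure.map_map (by fun_prop) (by fun_prop)]
    simp
  have h3 : ∀ᵐ x ∂((law s ℓ).map (fun w => w 0)), x = 0 := by
    rw [h2]; simp [ae_dirac_eq]
  exact ae_of_ae_map (measurable_pi_apply 0).aemeasurable h3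

lemma law_step (s ℓ t : ℕ) (w : ℕ → ℕ) :
    law s ℓ {x | ∀ r ≤ t + 1, x r = w r} = law s ℓ {x | ∀ r ≤ t, x r = w r} *
      (stepPMF ℓ (graph s w t) (w t)) (w (t + 1)) := by
  set u : (i : Finset.Iic t) → ℕ := Preorder.frestrictLe t w with hu
  have hmem : ∀ x : ℕ → ℕ, Preorder.frestrictLe (π := fun _ => ℕ) t x = u ↔
      ∀ r ≤ t, x r = w r := fun x =>
    ⟨fun h r hr => congrFun h ⟨r, Finset.mem_Iic.2 hr⟩,
      fun h => funext fun i => h i (Finset.mem_Iic.1 i.2)⟩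
  have key := Kernel.map_frestrictLe_trajMeasure_compProd_eq_map_trajMeasure
    (X := fun _ => ℕ) (μ₀ := Measure.dirac 0) (κ := stepKernel s ℓ) (a := t)
  have key2 := DFunLike.congr_fun key ({u} ×ˢ {w (t + 1)})
  rw [Measure.compProd_apply_prod (.singleton _) (.singleton _), Measure.restrict_singleton,
    lintegral_smul_measure, lintegral_dirac, Measure.map_apply (by fun_prop) (.singleton _),
    Measure.map_apply (by fun_prop) ((MeasurableSet.singleton _).prod (.singleton _))] at key2
  have hker : stepKernel s ℓ t u {w (t + 1)} =
      (stepPMF ℓ (graph s w t) (w t)) (w (t + 1)) := by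
    have e1 : ∀ r ≤ t, extend u r = w r := fun r hr => by simp [extend, hr, hu]
    change (stepPMF ℓ (graph s (extend u) t) (extend u t)).toMeasure {w (t + 1)} = _
    rw [graph_congr s e1, e1 t le_rfl, PMF.toMeasure_apply_singleton _ _ (.singleton _)]
  have hs1 : (Preorder.frestrictLe (π := fun _ => ℕ) t) ⁻¹' {u} = {x | ∀ r ≤ t, x r = w r} := by
    ext x; exact hmem x
  have hs2 : (fun x : ℕ → ℕ => (Preorder.frestrictLe (π := fun _ => ℕ) t x, x (t + 1))) ⁻¹'
      ({u} ×ˢ {w (t + 1)}) = {x | ∀ r ≤ t + 1, x r = w r} := by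
    ext x
    simp only [Set.mem_preimage, Set.mem_prod, Set.mem_singleton_iff, hmem, Set.mem_ofPred_eq]
    exact ⟨fun h r hr => (Nat.le_succ_iff.1 hr).elim (h.1 r) (fun e => e ▸ h.2),
      fun h => ⟨fun r hr => h r (hr.trans (Nat.le_succ t)), h _ le_rfl⟩⟩
  rw [hs1, hs2, hker, smul_eq_mul] at key2
  exact key2.symm

/-- For every step parameter the model exists, on the space of trajectories. -/
theorem isNRRW_law (s : ℕ) {ℓ : ℕ} (hℓ : 1 ≤ ℓ) : IsNRRW s ℓ (law s ℓ) (fun t w => w t) := by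
  have hpmf : ∀ (w : ℕ → ℕ) (t : ℕ), degree ℓ (graph s w t) (w t) ≠ 0 →
      (stepPMF ℓ (graph s w t) (w t)) (w (t + 1)) =
        stepProb ℓ (graph s w t) (w t) (w (t + 1)) := fun w t h => by
    rw [stepPMF, dif_pos h, PMF.ofFinset_apply]
  have hdeg : ∀ (w : ℕ → ℕ) (t : ℕ), law s ℓ {x | ∀ r ≤ t, x r = w r} ≠ 0 →
      ∃ y, s(w t, y) ∈ graph s w t := by
    intro w t
    induction t with
    | zero =>
      intro h
      refine ⟨0, ?_⟩
      have : w 0 = 0 := by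
        by_contra hw
        refine h (measure_mono_null (fun x hx => ?_) (law_start s ℓ))
        have := hx 0 le_rfl
        simp only [Set.mem_compl_iff, Set.mem_ofPred_eq]
        omega
      simp [graph, this]
    | succ t ih =>
      intro h
      rw [law_step] at h
      have hd := ih (left_ne_zero_of_mul h)
      have h2 := right_ne_zero_of_mul h
      rw [hpmf w t (degree_ne_zero hℓ hd)] at h2
      have hm : mult ℓ (graph s w t) (w t) (w (t + 1)) ≠ 0 := fun h0 => h2 (by simp [stepProb, h0])
      exact ⟨w t, graph_mono s w t (Sym2.eq_swap ▸ (mult_ne_zero hℓ).1 hm)⟩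
  refine ⟨fun t => measurable_pi_apply t, law_start s ℓ, fun t w => ?_⟩
  by_cases h0 : law s ℓ {x | ∀ r ≤ t, x r = w r} = 0
  · have := law_step s ℓ t w
    rw [h0, zero_mul] at this
    rw [h0, zero_mul, this]
  · rw [law_step, hpmf w t (degree_ne_zero hℓ (hdeg w t h0))]

end NRRW

namespace NRRW

/-! ### Trajectories in the growing tree -/

/-! A vertex `x` gains an edge only while the walker stands on it, apart from the root loop and the
edge `x` is born with. So after `m` earlier visits its degree is at most `2 * (m + 3)`, and the
chances of taking a given edge at `x` sum over the visits like a harmonic series. By Lévy's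
conditional Borel–Cantelli lemma, almost surely every edge at a vertex visited infinitely often is
traversed infinitely often (`IsNRRW.ae_frequently_traverse`). As the tree is connected, one vertex
visited infinitely often forces all of them to be. Such a vertex exists by parity
(`exists_frequently_of_loop_finite`). If the loop is used infinitely often, the root will do.
Otherwise depth plus time eventually keeps its parity; since `s` is even, the walker's depth at late
multiples of `s` has a fixed parity, and vertices born then have the other one. At those times the
walker therefore sits on one of finitely many early vertices. -/

lemma mem_graph_iff {s : ℕ} (hs : 0 < s) {w : ℕ → ℕ} {t : ℕ} {e : Sym2 ℕ} :
    e ∈ graph s w t ↔ e = s(0, 0) ∨ ∃ k, 0 < k ∧ k * s ≤ t ∧ e = s(k, w (k * s)) := by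
  induction t with
  | zero =>
    simp only [graph, Finset.mem_singleton]
    refine ⟨Or.inl, ?_⟩
    rintro (h | ⟨k, hk, hks, -⟩)
    · exact h
    · have := Nat.mul_pos hk hs
      omega
  | succ t ih =>
    by_cases h : s ∣ t + 1
    · obtain ⟨m, hm⟩ := h
      have hdiv : (t + 1) / s = m := by rw [hm, Nat.mul_div_cancel_left _ hs]
      have hdvd : s ∣ t + 1 := ⟨m, hm⟩
      have hm0 : 0 < m := by
        rcases Nat.eq_zero_or_pos m with rfl | h0
        · simp at hm
        · exact h0
      simp only [graph, if_pos hdvd, Finset.mem_insert, ih, hdiv]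
      constructor
      · rintro (h | h | ⟨k, hk, hks, h⟩)
        · exact Or.inr ⟨m, hm0, by rw [hm, mul_comm], by rw [h, hm, mul_comm]⟩
        · exact Or.inl h
        · exact Or.inr ⟨k, hk, by omega, h⟩
      · rintro (h | ⟨k, hk, hks, h⟩)
        · exact Or.inr (Or.inl h)
        · rcases Nat.lt_or_ge t (k * s) with h1 | h1
          · have hkt : k * s = t + 1 := by omega
            have hkm : k = m := Nat.eq_of_mul_eq_mul_right hs (by rw [hkt, hm, mul_comm])
            left
            rw [h, hkt, hkm]
          · exact Or.inr (Or.inr ⟨k, hk, h1, h⟩)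
    · simp only [graph, if_neg h, ih]
      refine or_congr_right (exists_congr fun k => and_congr_right fun _ => and_congr_left fun _ => ?_)
      have : k * s ≠ t + 1 := fun hk => h ⟨k, by rw [← hk, mul_comm]⟩
      omega

lemma graph_subset (s : ℕ) (w : ℕ → ℕ) {t u : ℕ} (h : t ≤ u) : graph s w t ⊆ graph s w u :=
  monotone_nat_of_le_succ (f := graph s w) (graph_mono s w) h

/-- A walker following the edges of the growing tree is at the root or at an older vertex. -/
lemma position_eq_zero_or_mul_lt {s : ℕ} (hs : 0 < s) {w : ℕ → ℕ} (h0 : w 0 = 0)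
    (hstep : ∀ t, s(w t, w (t + 1)) ∈ graph s w t) (t : ℕ) : w t = 0 ∨ w t * s < t := by
  induction t using Nat.strong_induction_on with
  | _ t ih =>
    rcases t with _ | t
    · exact Or.inl h0
    rcases (mem_graph_iff hs).1 (hstep t) with h | ⟨k, hk, hks, h⟩
    · rcases Sym2.eq_iff.1 h with h | h <;> exact Or.inl h.2
    · rcases Sym2.eq_iff.1 h with h | h
      · rw [h.2]
        rcases ih (k * s) (by omega) with h' | h'
        · exact Or.inl h'
        · right; omega
      · rw [h.2]
        right; omega

lemma parent_lt {s : ℕ} (hs : 0 < s) {w : ℕ → ℕ} (h0 : w 0 = 0)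
    (hstep : ∀ t, s(w t, w (t + 1)) ∈ graph s w t) {k : ℕ} (hk : 0 < k) : w (k * s) < k := by
  rcases position_eq_zero_or_mul_lt hs h0 hstep (k * s) with h | h
  · omega
  · exact Nat.lt_of_mul_lt_mul_right h

/-- The depth of a vertex in the forest in which the parent of `k` is `p k`, provided that
`p k < k`. -/
def depth (p : ℕ → ℕ) (k : ℕ) : ℕ := if p k < k then depth p (p k) + 1 else 0
termination_by k

lemma depth_eq_succ {p : ℕ → ℕ} {k : ℕ} (h : p k < k) : depth p k = depth p (p k) + 1 := by
  rw [depth, if_pos h]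

/-- A trajectory that traverses the loop at the root finitely often visits some vertex
infinitely often. -/
lemma exists_frequently_of_loop_finite {s : ℕ} (hs : 0 < s) (he : Even s) {w : ℕ → ℕ}
    (h0 : w 0 = 0) (hstep : ∀ t, s(w t, w (t + 1)) ∈ graph s w t)
    (hloop : ∀ᶠ t in atTop, ¬ (w t = 0 ∧ w (t + 1) = 0)) : ∃ x, ∃ᶠ t in atTop, w t = x := by
  obtain ⟨T, hT⟩ := eventually_atTop.1 hloop
  set d := depth (fun k => w (k * s)) with hd
  have hdk : ∀ k, 0 < k → d k = d (w (k * s)) + 1 := fun k hk =>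
    depth_eq_succ (p := fun k => w (k * s)) (parent_lt hs h0 hstep hk)
  -- Off the loop, each step changes both depth and time by one.
  have hpar : ∀ t, T ≤ t → (d (w (t + 1)) + (t + 1)) % 2 = (d (w t) + t) % 2 := by
    intro t ht
    rcases (mem_graph_iff hs).1 (hstep t) with h | ⟨k, hk, hks, h⟩
    · rcases Sym2.eq_iff.1 h with h | h <;> exact absurd ⟨h.1, h.2⟩ (hT t ht)
    · have := hdk k hk
      rcases Sym2.eq_iff.1 h with h | h
      · rw [h.1, h.2]; omega
      · rw [h.1, h.2]; omega
  have hconst : ∀ t, T ≤ t → (d (w t) + t) % 2 = (d (w T) + T) % 2 := by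
    intro t ht
    induction t, ht using Nat.le_induction with
    | base => rfl
    | succ t ht ih => rw [hpar t ht, ih]
  -- A vertex `j` above `T` is born after time `T`, so its depth parity is opposite to that of the
  -- walker at any late multiple of `s`.
  have hlt : ∀ k, T ≤ k * s → w (k * s) < T + 1 := by
    intro k hk
    by_contra hc
    set j := w (k * s) with hj
    have hjs : T ≤ j * s := by nlinarith
    have h1 := hconst _ hk
    have h2 := hconst _ hjs
    have h3 := hdk j (by omega)
    have e1 : Even (k * s) := he.mul_left k
    have e2 : Even (j * s) := he.mul_left j
    rw [← hj] at h1
    obtain ⟨a, ha⟩ := e1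
    obtain ⟨b, hb⟩ := e2
    omega
  by_contra! hc
  have hall : ∀ᶠ t in atTop, ∀ x ∈ Finset.range (T + 1), ¬ w t = x :=
    (Finset.eventually_all _).2 fun x _ => hc x
  obtain ⟨N, hN⟩ := eventually_atTop.1 hall
  have hk : N + T ≤ (N + T) * s := Nat.le_mul_of_pos_right _ hs
  exact hN ((N + T) * s) (by omega) _ (Finset.mem_range.2 (hlt (N + T) (by omega))) rfl

/-- If a trajectory traverses infinitely often every edge at every vertex that it visits
infinitely often, then it visits every vertex infinitely often. -/
lemma frequently_eq_of_traverse {s : ℕ} (hs : 0 < s) (he : Even s) {w : ℕ → ℕ} (h0 : w 0 = 0)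
    (hstep : ∀ t, s(w t, w (t + 1)) ∈ graph s w t)
    (htrav : ∀ x y, (∃ᶠ t in atTop, w t = x) → (∃ t, s(x, y) ∈ graph s w t) →
      ∃ᶠ t in atTop, w t = x ∧ w (t + 1) = y) (i : ℕ) : ∃ᶠ t in atTop, w t = i := by
  have hnext : ∀ x y, (∃ᶠ t in atTop, w t = x) → (∃ t, s(x, y) ∈ graph s w t) →
      ∃ᶠ t in atTop, w t = y := fun x y hx hxy =>
    (tendsto_add_atTop_nat 1).frequently ((htrav x y hx hxy).mono fun _ h => h.2)
  have hedge : ∀ k, 0 < k → s(k, w (k * s)) ∈ graph s w (k * s) := fun k hk =>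
    (mem_graph_iff hs).2 (Or.inr ⟨k, hk, le_rfl, rfl⟩)
  have hdown : ∀ x, (∃ᶠ t in atTop, w t = x) → ∃ᶠ t in atTop, w t = 0 := by
    intro x
    induction x using Nat.strong_induction_on with
    | _ x ih =>
      intro hx
      rcases Nat.eq_zero_or_pos x with rfl | hx0
      · exact hx
      · exact ih _ (parent_lt hs h0 hstep hx0) (hnext _ _ hx ⟨_, hedge x hx0⟩)
  have hroot : ∃ᶠ t in atTop, w t = 0 := by
    by_cases hloop : ∃ᶠ t in atTop, w t = 0 ∧ w (t + 1) = 0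
    · exact hloop.mono fun _ h => h.1
    · obtain ⟨x, hx⟩ := exists_frequently_of_loop_finite hs he h0 hstep (not_frequently.1 hloop)
      exact hdown x hx
  induction i using Nat.strong_induction_on with
  | _ i ih =>
    rcases Nat.eq_zero_or_pos i with rfl | hi
    · exact hroot
    · exact hnext _ _ (ih _ (parent_lt hs h0 hstep hi)) ⟨i * s, Sym2.eq_swap ▸ hedge i hi⟩

/-! ### Bounds on degrees and step probabilities -/

lemma mult_le_degree (ℓ : ℕ) (E : Finset (Sym2 ℕ)) (x y : ℕ) : mult ℓ E x y ≤ degree ℓ E x := by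
  by_cases hy : y ∈ verts E
  · exact Finset.single_le_sum (f := fun y => mult ℓ E x y) (fun _ _ => Nat.zero_le _) hy
  · have : s(x, y) ∉ E := fun hE => hy (Finset.mem_biUnion.2 ⟨_, hE, by simp⟩)
    simp [mult, this]

lemma stepProb_le_one (ℓ : ℕ) (E : Finset (Sym2 ℕ)) (x y : ℕ) : stepProb ℓ E x y ≤ 1 :=
  ENNReal.div_le_of_le_mul (by rw [one_mul]; exact_mod_cast mult_le_degree ℓ E x y)

lemma mem_of_stepProb_ne_zero {ℓ : ℕ} {E : Finset (Sym2 ℕ)} {x y : ℕ}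
    (h : stepProb ℓ E x y ≠ 0) : s(x, y) ∈ E := by
  by_contra hE
  exact h (by simp [stepProb, mult, hE])

/-- The factor 2 absorbs a loop counted twice, which treats both conventions at once. -/
lemma degree_le_card {ℓ : ℕ} (hℓ : ℓ ≤ 2) (E : Finset (Sym2 ℕ)) (x : ℕ) :
    degree ℓ E x ≤ 2 * (E.filter (x ∈ ·)).card := by
  have h1 : degree ℓ E x ≤ ∑ y ∈ verts E, if s(x, y) ∈ E then 2 else 0 := by
    refine Finset.sum_le_sum fun y _ => ?_
    unfold mult
    split_ifs <;> omega
  refine h1.trans ?_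
  rw [← Finset.sum_filter, Finset.sum_const, smul_eq_mul, mul_comm]
  refine Nat.mul_le_mul_left 2 (Finset.card_le_card_of_injOn (fun y => s(x, y)) ?_ ?_)
  · intro y hy
    simp only [Finset.coe_filter, Set.mem_ofPred_eq] at hy ⊢
    exact ⟨hy.2, by simp⟩
  · intro y _ z _ h
    rcases Sym2.eq_iff.1 h with h | h
    · exact h.2
    · exact h.2.trans h.1

/-- Every other edge at `x` is born during a visit to `x`. The 3 pays for the loop, the edge from
`x` to its parent, and time `t` itself, which `Nat.count` leaves out. -/
lemma card_incident_le {s : ℕ} (hs : 0 < s) (w : ℕ → ℕ) (t x : ℕ) :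
    ((graph s w t).filter (x ∈ ·)).card ≤ Nat.count (fun r => w r = x) t + 3 := by
  have hsub : (graph s w t).filter (x ∈ ·) ⊆
      insert s(0, 0) (insert s(x, w (x * s))
        (((Finset.range (t + 1)).filter (fun r => w r = x)).image (fun r => s(r / s, x)))) := by
    intro e he
    obtain ⟨he, hx⟩ := Finset.mem_filter.1 he
    simp only [Finset.mem_insert, Finset.mem_image, Finset.mem_filter, Finset.mem_range]
    rcases (mem_graph_iff hs).1 he with h | ⟨k, hk, hks, rfl⟩
    · exact Or.inl h
    · rcases Sym2.mem_iff.1 hx with rfl | rfl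
      · exact Or.inr (Or.inl rfl)
      · exact Or.inr (Or.inr ⟨k * s, ⟨by omega, rfl⟩, by rw [Nat.mul_div_cancel _ hs]⟩)
  refine (Finset.card_le_card hsub).trans ((Finset.card_insert_le _ _).trans ?_)
  have h1 := Finset.card_insert_le s(x, w (x * s))
    (((Finset.range (t + 1)).filter (fun r => w r = x)).image (fun r => s(r / s, x)))
  have h2 := Finset.card_image_le (s := (Finset.range (t + 1)).filter (fun r => w r = x))
    (f := fun r => s(r / s, x))
  rw [← Nat.count_eq_card_filter_range, Nat.count_succ] at h2
  split_ifs at h2 <;> omega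

lemma le_stepProb {s ℓ : ℕ} (hs : 0 < s) (hℓ1 : 1 ≤ ℓ) (hℓ2 : ℓ ≤ 2) (w : ℕ → ℕ) {t x y : ℕ}
    (h : s(x, y) ∈ graph s w t) :
    1 / (2 * ((Nat.count (fun r => w r = x) t : ℝ) + 3)) ≤
      (stepProb ℓ (graph s w t) x y).toReal := by
  have hd0 : degree ℓ (graph s w t) x ≠ 0 := degree_ne_zero hℓ1 ⟨y, h⟩
  have hm : 1 ≤ mult ℓ (graph s w t) x y := Nat.one_le_iff_ne_zero.2 ((mult_ne_zero hℓ1).2 h)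
  have hd : degree ℓ (graph s w t) x ≤ 2 * (Nat.count (fun r => w r = x) t + 3) :=
    (degree_le_card hℓ2 _ _).trans (Nat.mul_le_mul_left 2 (card_incident_le hs w t x))
  rw [stepProb, ENNReal.toReal_div, ENNReal.toReal_natCast, ENNReal.toReal_natCast]
  refine div_le_div₀ (Nat.cast_nonneg _) (by exact_mod_cast hm)
    (by exact_mod_cast Nat.pos_of_ne_zero hd0) (by exact_mod_cast hd)

/-! ### A divergent series along the visits to a vertex -/

/-- Reindexes a sum over times by the number of earlier visits, which turns the degree bound into a
harmonic series. -/
lemma sum_ite_count {M : Type*} [AddCommMonoid M] (p : ℕ → Prop) [DecidablePred p] (f : ℕ → M)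
    (n : ℕ) :
    ∑ t ∈ Finset.range n, (if p t then f (Nat.count p t) else 0) =
      ∑ m ∈ Finset.range (Nat.count p n), f m := by
  induction n with
  | zero => simp
  | succ n ih =>
    rw [Finset.sum_range_succ, ih, Nat.count_succ]
    split_ifs
    · rw [Finset.sum_range_succ]
    · simp

lemma tendsto_count_atTop {p : ℕ → Prop} [DecidablePred p] (h : ∃ᶠ t in atTop, p t) :
    Tendsto (Nat.count p) atTop atTop := by
  refine tendsto_atTop_atTop.2 fun b => ⟨Nat.nth p b, fun a ha => ?_⟩
  rw [← Nat.count_nth_of_infinite (Nat.frequently_atTop_iff_infinite.1 h) b]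
  exact Nat.count_monotone p ha

lemma tendsto_sum_visits {p : ℕ → Prop} [DecidablePred p] (h : ∃ᶠ t in atTop, p t) :
    Tendsto (fun n => ∑ t ∈ Finset.range n,
      (if p t then 1 / (2 * ((Nat.count p t : ℝ) + 3)) else 0)) atTop atTop := by
  have hdiv : Tendsto (fun n => ∑ m ∈ Finset.range n, 1 / (2 * ((m : ℝ) + 3))) atTop atTop := by
    refine (not_summable_iff_tendsto_nat_atTop_of_nonneg fun m => by positivity).1 fun hsum => ?_
    have h2 : Summable fun m : ℕ => 1 / ((m + 3 : ℕ) : ℝ) := by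
      refine (hsum.mul_left 2).congr fun m => ?_
      push_cast
      field_simp
    exact Real.not_summable_one_div_natCast ((summable_nat_add_iff 3).1 h2)
  simp_rw [sum_ite_count p (fun m => 1 / (2 * ((m : ℝ) + 3)))]
  exact hdiv.comp (tendsto_count_atTop h)

/-! ### Conditional probabilities given the past -/

section Past

variable {Ω : Type*} {s ℓ : ℕ} {W : ℕ → Ω → ℕ}

/-- The trajectory up to time `t`. -/
def past (W : ℕ → Ω → ℕ) (t : ℕ) (ω : Ω) : (i : Finset.Iic t) → ℕ := fun i => W i ω

lemma extend_past {t r : ℕ} (h : r ≤ t) (ω : Ω) : extend (past W t ω) r = W r ω := by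
  simp [extend, past, h]

lemma past_eq_iff {t : ℕ} {u : (i : Finset.Iic t) → ℕ} {ω : Ω} :
    past W t ω = u ↔ ∀ r ≤ t, W r ω = extend u r := by
  constructor
  · rintro rfl r hr
    rw [extend_past hr]
  · intro h
    funext i
    have hi := Finset.mem_Iic.1 i.2
    have := h i hi
    simpa [extend, past, hi] using this

/-- The probability, given the past `u`, that the walker is at `x` and moves to `y`. -/
noncomputable def traverseProb (s ℓ t x y : ℕ) (u : (i : Finset.Iic t) → ℕ) : ℝ≥0∞ :=
  if extend u t = x then stepProb ℓ (graph s (extend u) t) x y else 0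

lemma traverseProb_le_one (s ℓ t x y : ℕ) (u : (i : Finset.Iic t) → ℕ) :
    traverseProb s ℓ t x y u ≤ 1 := by
  unfold traverseProb
  split_ifs
  · exact stepProb_le_one _ _ _ _
  · exact zero_le_one

lemma traverseProb_past (t x y : ℕ) (ω : Ω) : traverseProb s ℓ t x y (past W t ω) =
    if W t ω = x then stepProb ℓ (graph s (fun r => W r ω) t) x y else 0 := by
  rw [traverseProb, extend_past le_rfl,
    graph_congr s (w' := fun r => W r ω) fun r hr => extend_past hr ω]

variable [MeasurableSpace Ω] {P : Measure Ω}

lemma measurable_past (hW : ∀ t, Measurable (W t)) (t : ℕ) : Measurable (past W t) :=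
  measurable_pi_lambda _ fun i => hW i

/-- The filtration generated by the walker. -/
def history (hW : ∀ t, Measurable (W t)) : Filtration ℕ ‹MeasurableSpace Ω› where
  seq t := MeasurableSpace.comap (past W t) inferInstance
  mono' := by
    intro t u htu
    have : past W t = (fun (v : Finset.Iic u → ℕ) (i : Finset.Iic t) => v ⟨i, Finset.mem_Iic.2 ((Finset.mem_Iic.1 i.2).trans htu)⟩) ∘
        past W u := rfl
    change MeasurableSpace.comap (past W t) _ ≤ MeasurableSpace.comap (past W u) _
    rw [this, ← MeasurableSpace.comap_comp]
    refine MeasurableSpace.comap_mono (Measurable.comap_le ?_)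
    exact measurable_pi_lambda _ fun i => measurable_pi_apply _
  le' t := (measurable_past hW t).comap_le

lemma measurable_history_of_le (hW : ∀ t, Measurable (W t)) {r t : ℕ} (h : r ≤ t) :
    Measurable[history hW t] (W r) := by
  have : W r = (fun v : (i : Finset.Iic t) → ℕ => v ⟨r, Finset.mem_Iic.2 h⟩) ∘ past W t := rfl
  rw [this]
  exact (measurable_pi_apply _).comp (comap_measurable _)

lemma IsNRRW.measure_traverse (hW : IsNRRW s ℓ P W) {t : ℕ} (x y : ℕ)
    (u : (i : Finset.Iic t) → ℕ) :
    P (past W t ⁻¹' {u} ∩ {ω | W t ω = x ∧ W (t + 1) ω = y}) =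
      traverseProb s ℓ t x y u * P (past W t ⁻¹' {u}) := by
  unfold traverseProb
  split_ifs with hx
  -- `hW.step` takes a whole trajectory, but only its values up to `t + 1` matter.
  · set w : ℕ → ℕ := Function.update (extend u) (t + 1) y with hw
    have hwr : ∀ r ≤ t, w r = extend u r := fun r hr =>
      Function.update_of_ne (by omega) _ _
    have hwt : w (t + 1) = y := Function.update_self _ _ _
    have h := hW.step t w
    rw [graph_congr s hwr, hwr t le_rfl, hwt, hx] at h
    have e1 : past W t ⁻¹' {u} = {ω | ∀ r ≤ t, W r ω = w r} := by
      ext ω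
      simp only [Set.mem_preimage, Set.mem_singleton_iff, past_eq_iff, Set.mem_ofPred_eq]
      exact forall₂_congr fun r hr => by rw [hwr r hr]
    have e2 : past W t ⁻¹' {u} ∩ {ω | W t ω = x ∧ W (t + 1) ω = y} =
        {ω | ∀ r ≤ t + 1, W r ω = w r} := by
      rw [e1]
      ext ω
      simp only [Set.mem_inter_iff, Set.mem_ofPred_eq]
      constructor
      · rintro ⟨h1, -, h2⟩ r hr
        rcases Nat.le_succ_iff.1 hr with hr | rfl
        · exact h1 r hr
        · rw [hwt, h2]
      · intro h1
        refine ⟨fun r hr => h1 r (by omega), ?_, ?_⟩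
        · rw [h1 t (by omega), hwr t le_rfl, hx]
        · rw [h1 _ le_rfl, hwt]
    rw [e2, e1, h, mul_comm]
  · have : past W t ⁻¹' {u} ∩ {ω | W t ω = x ∧ W (t + 1) ω = y} = ∅ := by
      ext ω
      simp only [Set.mem_inter_iff, Set.mem_preimage, Set.mem_singleton_iff, Set.mem_ofPred_eq,
        Set.mem_empty_iff_false, iff_false]
      rintro ⟨rfl, h, -⟩
      exact hx (by rw [extend_past le_rfl, h])
    rw [this, measure_empty, zero_mul]

lemma IsNRRW.measurableSet_traverse (hW : IsNRRW s ℓ P W) (t x y : ℕ) :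
    MeasurableSet {ω | W t ω = x ∧ W (t + 1) ω = y} :=
  (hW.measurable t (.singleton x)).inter (hW.measurable (t + 1) (.singleton y))

/-- There are countably many pasts, so the identity is summed over the single ones. -/
lemma IsNRRW.setLIntegral_traverseProb (hW : IsNRRW s ℓ P W) (t x y : ℕ)
    (B : Set ((i : Finset.Iic t) → ℕ)) :
    ∫⁻ ω in past W t ⁻¹' B, traverseProb s ℓ t x y (past W t ω) ∂P =
      P (past W t ⁻¹' B ∩ {ω | W t ω = x ∧ W (t + 1) ω = y}) := by
  have hB : MeasurableSet B := B.to_countable.measurableSet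
  have hp := measurable_past hW.measurable t
  rw [← setLIntegral_map hB (measurable_of_countable (traverseProb s ℓ t x y)) hp,
    lintegral_countable _ B.to_countable]
  have hU : past W t ⁻¹' B ∩ {ω | W t ω = x ∧ W (t + 1) ω = y} =
      ⋃ u : B, past W t ⁻¹' {u.1} ∩ {ω | W t ω = x ∧ W (t + 1) ω = y} := by
    ext ω
    simp
    tauto
  rw [hU, measure_iUnion]
  · refine tsum_congr fun u => ?_
    rw [hW.measure_traverse, Measure.map_apply hp (.singleton _)]
  · intro u v huv
    refine Set.disjoint_left.2 fun ω h1 h2 => huv (Subtype.ext ?_)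
    exact h1.1.symm.trans h2.1
  · exact fun u => (hp (.singleton _)).inter (hW.measurableSet_traverse t x y)

lemma IsNRRW.condExp_traverse [IsProbabilityMeasure P] (hW : IsNRRW s ℓ P W) (t x y : ℕ) :
    (fun ω => (traverseProb s ℓ t x y (past W t ω)).toReal) =ᵐ[P]
      P[({ω | W t ω = x ∧ W (t + 1) ω = y} : Set Ω).indicator (1 : Ω → ℝ) |
        history hW.measurable t] := by
  have hp := measurable_past hW.measurable t
  have hA := hW.measurableSet_traverse t x y
  have hm : Measurable (traverseProb s ℓ t x y) := measurable_of_countable _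
  have hgm : Measurable[history hW.measurable t]
      (fun ω => (traverseProb s ℓ t x y (past W t ω)).toReal) :=
    (ENNReal.measurable_toReal.comp hm).comp (comap_measurable _)
  have hgi : Integrable (fun ω => (traverseProb s ℓ t x y (past W t ω)).toReal) P := by
    refine Integrable.of_bound (C := 1)
      (hgm.mono ((history hW.measurable).le t) le_rfl).aestronglyMeasurable
      (ae_of_all _ fun ω => ?_)
    rw [Real.norm_of_nonneg ENNReal.toReal_nonneg]
    exact ENNReal.toReal_le_of_le_ofReal zero_le_one
      (by simpa using traverseProb_le_one s ℓ t x y _)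
  refine ae_eq_condExp_of_forall_setIntegral_eq ((history hW.measurable).le t)
    ((integrable_const (1 : ℝ)).indicator hA) (fun _ _ _ => hgi.integrableOn) ?_
    hgm.stronglyMeasurable.aestronglyMeasurable
  rintro _ ⟨B, hB, rfl⟩ -
  rw [integral_toReal (f := fun ω => traverseProb s ℓ t x y (past W t ω))
    (hm.comp hp).aemeasurable
    (ae_of_all _ fun ω => (traverseProb_le_one s ℓ t x y _).trans_lt ENNReal.one_lt_top),
    hW.setLIntegral_traverseProb, integral_indicator_one hA, Measure.real,
    Measure.restrict_apply hA, Set.inter_comm]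

/-- Every step of the walker follows an edge of the current graph. -/
lemma IsNRRW.ae_step_mem (hW : IsNRRW s ℓ P W) :
    ∀ᵐ ω ∂P, ∀ t, s(W t ω, W (t + 1) ω) ∈ graph s (fun r => W r ω) t := by
  refine ae_all_iff.2 fun t => ?_
  -- Countably many pairs of a past and a next position; each one that leaves the graph has
  -- probability zero.
  have hnull : ∀ q : ((i : Finset.Iic t) → ℕ) × ℕ, ∀ᵐ ω ∂P, past W t ω = q.1 →
      W (t + 1) ω = q.2 → s(W t ω, W (t + 1) ω) ∈ graph s (fun r => W r ω) t := by
    rintro ⟨u, y⟩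
    by_cases hE : s(extend u t, y) ∈ graph s (extend u) t
    · refine ae_of_all _ fun ω h1 h2 => ?_
      rw [← extend_past (W := W) (le_refl t) ω,
        ← graph_congr s (w := extend (past W t ω)) fun r hr => extend_past hr ω, h1, h2]
      exact hE
    · have h0 := hW.measure_traverse (extend u t) y u
      rw [traverseProb, if_pos rfl, not_imp_comm.1 mem_of_stepProb_ne_zero hE, zero_mul] at h0
      refine measure_mono_null (fun ω hω => ?_) h0
      simp only [Set.mem_compl_iff, Set.mem_ofPred_eq, Classical.not_imp] at hω
      exact ⟨hω.1, by rw [← hω.1, extend_past le_rfl], hω.2.1⟩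
  filter_upwards [ae_all_iff.2 hnull] with ω hω
  exact hω (past W t ω, W (t + 1) ω) rfl rfl

/-- Almost surely, an edge at a vertex visited infinitely often is traversed infinitely often. -/
lemma IsNRRW.ae_frequently_traverse [IsProbabilityMeasure P] (hW : IsNRRW s ℓ P W) (hs : 0 < s)
    (hℓ1 : 1 ≤ ℓ) (hℓ2 : ℓ ≤ 2) (x y : ℕ) :
    ∀ᵐ ω ∂P, (∃ᶠ t in atTop, W t ω = x) → (∃ t, s(x, y) ∈ graph s (fun r => W r ω) t) →
      ∃ᶠ t in atTop, W t ω = x ∧ W (t + 1) ω = y := by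
  -- The index is the arrival time, so that `A n` is known at time `n`; `0 < n` guards the truncated
  -- `n - 1`.
  set A : ℕ → Set Ω := fun n => {ω | 0 < n ∧ W (n - 1) ω = x ∧ W n ω = y} with hAdef
  have hA : ∀ n, MeasurableSet[history hW.measurable n] (A n) := fun n =>
    (MeasurableSet.const _).inter
      ((measurable_history_of_le hW.measurable (Nat.sub_le n 1) (.singleton x)).inter
        (measurable_history_of_le hW.measurable le_rfl (.singleton y)))
  have hA1 : ∀ t, A (t + 1) = {ω | W t ω = x ∧ W (t + 1) ω = y} := fun t => by
    ext ω
    simp [hAdef]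
  filter_upwards [ae_mem_limsup_atTop_iff P hA,
    ae_all_iff.2 fun t => hW.condExp_traverse t x y] with ω hω hcond hx ⟨t₀, ht₀⟩
  -- Lévy's lemma reduces this to divergence of the summed conditional probabilities.
  have hlim : ω ∈ limsup A atTop := by
    refine hω.2 ?_
    refine Tendsto.congr (f₁ := fun n => ∑ t ∈ Finset.range n,
      (traverseProb s ℓ t x y (past W t ω)).toReal) (fun n => ?_) ?_
    · refine Finset.sum_congr rfl fun t _ => ?_
      rw [hA1]
      exact hcond t
    · have hsum := tendsto_sum_visits (p := fun t => W t ω = x) hx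
      set f : ℕ → ℝ := fun t =>
        if W t ω = x then 1 / (2 * ((Nat.count (fun t => W t ω = x) t : ℝ) + 3)) else 0 with hf
      -- The lower bound needs the edge to be present, hence the finitely many terms before `t₀` are
      -- dropped.
      refine tendsto_atTop_mono' _ (eventually_atTop.2 ⟨t₀, fun n hn => ?_⟩)
        (tendsto_atTop_add_const_right _ (-∑ t ∈ Finset.range t₀, f t) hsum)
      change ∑ t ∈ Finset.range n, f t + _ ≤ _
      rw [← sub_eq_add_neg, ← Finset.sum_Ico_eq_sub _ hn]
      have hle : ∀ t ∈ Finset.Ico t₀ n, f t ≤ (traverseProb s ℓ t x y (past W t ω)).toReal := by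
        intro t ht
        rw [traverseProb_past, hf]
        dsimp only
        split_ifs
        · exact le_stepProb hs hℓ1 hℓ2 _ (graph_subset s _ (Finset.mem_Ico.1 ht).1 ht₀)
        · exact le_rfl
      refine (Finset.sum_le_sum hle).trans (Finset.sum_le_sum_of_subset_of_nonneg ?_
        fun _ _ _ => ENNReal.toReal_nonneg)
      intro t ht
      exact Finset.mem_range.2 (Finset.mem_Ico.1 ht).2
  have hfreq : ∃ᶠ n in atTop, ω ∈ A n := mem_limsup_iff_frequently_mem.1 hlim
  rw [frequently_atTop] at hfreq ⊢
  intro a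
  obtain ⟨b, hb, h0, h1, h2⟩ := hfreq (a + 1)
  refine ⟨b - 1, by omega, h1, ?_⟩
  rw [Nat.sub_add_cancel h0]
  exact h2

end Past

end NRRW

theorem theorem4 {Ω : Type*} [MeasurableSpace Ω] (P : Measure Ω) [IsProbabilityMeasure P]
    (s : ℕ) (hs : Even s) (hs0 : 0 < s) (ℓ : ℕ) (hℓ : ℓ = 1 ∨ ℓ = 2)
    (W : ℕ → Ω → ℕ) (hW : NRRW.IsNRRW s ℓ P W) :
    ∀ i : ℕ, NRRW.Recurrent P W i := by
  intro i
  -- Countably many pairs `x`, `y` share one null set; off it the argument is deterministic.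
  filter_upwards [hW.start, hW.ae_step_mem, ae_all_iff.2 fun x => ae_all_iff.2 fun y =>
    hW.ae_frequently_traverse hs0 (by omega) (by omega) x y] with ω h0 hstep htrav
  exact NRRW.frequently_eq_of_traverse hs0 hs h0 hstep htrav i
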